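/- Let $1 \le r < n$ and let $A \in \mathbb{R}^{n\times n}$ be symmetric with eigenvalues $\lambda_1 \ge \dots \ge \lambda_r > \lambda_{r+1} \ge \dots \ge \lambda_n$ and eigenvalue decomposition $A = V\Lambda V^{T} + V_\perp \Lambda_\perp V_\perp^{T}$, where $\Lambda = \mathrm{diag}(\lambda_1,\dots,\lambda_r)$, $\Lambda_\perp = \mathrm{diag}(\lambda_{r+1},\dots,\lambda_n)$, and $V \in \mathbb{R}^{n\times r}$, $V_\perp \in \mathbb{R}^{n\times(n-r)}$ satisfy $V^{T}V = I$, $V_\perp^{T}V_\perp = I$, $V^{T}V_\perp = 0$. Write $\|\cdot\|_2$ for the spectral norm, $\|M\|_{2\to\infty}$ for the largest Euclidean norm of a row of $M$, and $$\mathrm{dist}_{2\to\infty}(V,Q) = \inf\{\|V - QO\|_{2\to\infty} : O \in \mathbb{R}^{r\times r},\ O^{T}O = I\}.$$ Let $$\mathsf{gap} = \min\Big\{\lambda_r - \lambda_{r+1},\ \inf\big\{\|Z\Lambda - V_\perp\Lambda_\perp V_\perp^{T} Z\|_{2\to\infty} : Z = V_\perp X \text{ for some } X\in\mathbb{R}^{(n-r)\times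 r},\ \|Z\|_{2\to\infty} = 1\big\}\Big\},$$ and let $\mu$ be the coherence of $V$, i.e. the smallest $\mu > 0$ with $\|V\|_{2\to\infty} \le \mu\sqrt{r/n}$. Let $Q \in \mathbb{R}^{n\times r}$ with $Q^{T}Q = I$, let $S \in \mathbb{R}^{r\times r}$ be symmetric, and put $E = AQ - QS$. Suppose that the columns of $Q$ span a leading invariant subspace of $A - EQ^{T}$, i.e. an invariant subspace on which $A - EQ^{T}$ carries its $r$ algebraically largest eigenvalues, counted with algebraic multiplicity (eigenvalues are compared by real parts), and that $\|E\|_2 \le \mathsf{gap}/5$. If $\|E\|_2 \le \varepsilon_1$ and $\|E\|_{2\to\infty} \le \varepsilon_2$, then $$\mathrm{dist}_{2\to\infty}(V,Q) \le 8\mu\sqrt{\frac{r}{n}}\left(\frac{\varepsilon_1}{\lambda_r-\lambda_{r+1}}\right)^2 + 2\,\frac{1+\mu\sqrt{r}}{\mathsf{gap}}\left(\varepsilon_2 + \frac{2\varepsilon_1\varepsilon_2}{\lambda_r-\lambda_{r+1}}\right).$$ -/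

import Mathlib

open scoped Matrix

noncomputable section

/-- The spectral norm `‖M‖₂`: the operator norm of `M` between Euclidean spaces
(Mathlib's `ℓ²` operator norm on matrices). -/
def specNorm {m k : ℕ} (M : Matrix (Fin m) (Fin k) ℝ) : ℝ :=
  Matrix.instL2OpNormedAddCommGroup.toNorm.norm M

/-- The norm `‖M‖_{2→∞}`: the largest Euclidean norm of a row of `M`. -/
def twoInftyNorm {m k : ℕ} (M : Matrix (Fin m) (Fin k) ℝ) : ℝ :=
  ⨆ i : Fin m, ‖WithLp.toLp 2 (M i)‖

/-- `dist_{2→∞}(V, U) = inf_O ‖V - U O‖_{2→∞}`, over the orthogonal `r × r` matrices `O`. -/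
def distTwoInfty {n r : ℕ} (V U : Matrix (Fin n) (Fin r) ℝ) : ℝ :=
  ⨅ O : Matrix.orthogonalGroup (Fin r) ℝ,
    twoInftyNorm (V - U * (O : Matrix (Fin r) (Fin r) ℝ))

/-- `μ` is the coherence of `V`: the smallest `μ > 0` with `‖V‖_{2→∞} ≤ μ √(r / n)`. -/
def IsCoherence {n r : ℕ} (V : Matrix (Fin n) (Fin r) ℝ) (μ : ℝ) : Prop :=
  IsLeast {c : ℝ | 0 < c ∧ twoInftyNorm V ≤ c * √((r : ℝ) / n)} μ

/-- The separation of `B` and `C` along the column space of `W`, in the norm `N`: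
`inf { N (Z B - C Z) | N Z = 1, Z ∈ range W }`, where `Z ∈ range W` means `Z = W X`. -/
def sep {n r m : ℕ} (N : Matrix (Fin n) (Fin r) ℝ → ℝ) (W : Matrix (Fin n) (Fin m) ℝ)
    (B : Matrix (Fin r) (Fin r) ℝ) (C : Matrix (Fin n) (Fin n) ℝ) : ℝ :=
  sInf {t : ℝ | ∃ Z : Matrix (Fin n) (Fin r) ℝ,
    N Z = 1 ∧ (∃ X : Matrix (Fin m) (Fin r) ℝ, Z = W * X) ∧ t = N (Z * B - C * Z)}

/-- The eigenvalues of a symmetric matrix with multiplicity, in nonincreasing order. The index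
starts at `0`, so that `λ_k(A)` is `eig hA ⟨k - 1, _⟩`. -/
def eig {n : ℕ} {A : Matrix (Fin n) (Fin n) ℝ} (hA : A.IsHermitian) (i : Fin n) : ℝ :=
  hA.eigenvalues₀ (Fin.cast (Fintype.card_fin n).symm i)

/-- `Λ = diag(λ_1, …, λ_r)`. -/
def eigTop {n : ℕ} {A : Matrix (Fin n) (Fin n) ℝ} (hA : A.IsHermitian) {r : ℕ} (hr : r < n) :
    Matrix (Fin r) (Fin r) ℝ :=
  Matrix.diagonal fun i => eig hA ⟨i, i.isLt.trans hr⟩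

/-- `Λ_⊥ = diag(λ_{r+1}, …, λ_n)`. -/
def eigBot {n : ℕ} {A : Matrix (Fin n) (Fin n) ℝ} (hA : A.IsHermitian) (r : ℕ) :
    Matrix (Fin (n - r)) (Fin (n - r)) ℝ :=
  Matrix.diagonal fun i => eig hA ⟨r + i, by have := i.isLt; omega⟩

/-- The eigengap `λ_r(A) - λ_{r+1}(A)`. -/
def eigengap {n : ℕ} {A : Matrix (Fin n) (Fin n) ℝ} (hA : A.IsHermitian) {r : ℕ} (hr : r < n) :
    ℝ :=
  eig hA ⟨r - 1, lt_of_le_of_lt (Nat.sub_le r 1) hr⟩ - eig hA ⟨r, hr⟩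

/-- `gap = min {λ_r - λ_{r+1}, sep_{(2,∞), V_⊥}(Λ, V_⊥ Λ_⊥ V_⊥ᵀ)}`. -/
def gap {n : ℕ} {A : Matrix (Fin n) (Fin n) ℝ} (hA : A.IsHermitian) {r : ℕ} (hr : r < n)
    (Vp : Matrix (Fin n) (Fin (n - r)) ℝ) : ℝ :=
  min (eigengap hA hr) (sep twoInftyNorm Vp (eigTop hA hr) (Vp * eigBot hA r * Vpᵀ))

/-- The complex eigenvalues of a real square matrix, with algebraic multiplicity. -/
def cEigenvalues {k : ℕ} (M : Matrix (Fin k) (Fin k) ℝ) : Multiset ℂ :=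
  (M.map (algebraMap ℝ ℂ)).charpoly.roots

/-- For `Q` with orthonormal columns and a square matrix `M` that need not be symmetric: the column
space of `Q` is an invariant subspace of `M`, and `M` restricted to it (the matrix `Qᵀ M Q`)
carries the `r` algebraically largest eigenvalues of `M`, counted with algebraic multiplicity.
Eigenvalues that are not real are compared by their real parts. -/
def IsLeadingInvariant {n r : ℕ} (M : Matrix (Fin n) (Fin n) ℝ)
    (Q : Matrix (Fin n) (Fin r) ℝ) : Prop :=
  M * Q = Q * (Qᵀ * M * Q) ∧
    ∀ w ∈ cEigenvalues (Qᵀ * M * Q), ∀ z ∈ cEigenvalues M - cEigenvalues (Qᵀ * M * Q),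
      z.re ≤ w.re

end

/-! Put `C = Vᵀ Q` and `D = V_⊥ᵀ Q`, so that `Q = V C + V_⊥ D`. Choose `O` orthogonal so that `C O`
is the positive semidefinite square root of `C Cᵀ`. With `Z = V_⊥ D C⁻¹`, this gives `V - Q O = V (1
- C O) - Z (C O)`, and the two terms are bounded separately (`distTwoInfty_le_add_twoInftyNorm`).

The first term is quadratic in `D`: `‖1 - C O‖ ≤ ‖1 - C Cᵀ‖ ≤ ‖D‖² ‖C⁻¹‖`. A Davis–Kahan argument
bounds `D` (`eigengap_sub_mul_specNorm_le`). Since `Λ_⊥ D - D S = V_⊥ᵀ E`, it is enough that the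
least eigenvalue of `S` is at least `λ_r - 2‖E‖`. That bound combines a dimension count
(`le_add_two_mul_specNorm`) with the leading property of `Q`, which keeps the compression of `A` to
the complement of `Q` below the spectrum of `S`.

The second term is controlled row by row: `Z` solves `Z Λ - V_⊥ Λ_⊥ V_⊥ᵀ Z = (Z VᵀE - V_⊥ V_⊥ᵀ E)
C⁻¹` (`sylvester_mul_inv_eq`). The separation bounds the left side below by `gap ‖Z‖`, and `‖E‖₂ ≤
gap/5` lets the `Z` on the right be absorbed. -/

/-! ### Euclidean, spectral and two-to-infinity norms. -/

theorem norm_toLp_sq {ι : Type*} [Fintype ι] (x : ι → ℝ) :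
    ‖WithLp.toLp 2 x‖ ^ 2 = x ⬝ᵥ x := by
  rw [EuclideanSpace.real_norm_sq_eq]
  simp [dotProduct, sq]

theorem norm_toLp_eq_one {ι : Type*} [Fintype ι] {x : ι → ℝ} (h : x ⬝ᵥ x = 1) :
    ‖WithLp.toLp 2 x‖ = 1 :=
  (pow_eq_one_iff_of_nonneg (norm_nonneg _) two_ne_zero).1 ((norm_toLp_sq x).trans h)

theorem abs_dotProduct_le_norm {ι : Type*} [Fintype ι] (x y : ι → ℝ) :
    |x ⬝ᵥ y| ≤ ‖WithLp.toLp 2 x‖ * ‖WithLp.toLp 2 y‖ := by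
  have h := abs_real_inner_le_norm (WithLp.toLp 2 y) (WithLp.toLp 2 x)
  rw [EuclideanSpace.inner_toLp_toLp, star_trivial] at h
  rwa [mul_comm]

section SpecNorm

open scoped Matrix.Norms.L2Operator

theorem specNorm_nonneg {m k : ℕ} (M : Matrix (Fin m) (Fin k) ℝ) : 0 ≤ specNorm M :=
  norm_nonneg M

theorem specNorm_mul_le {m k l : ℕ} (M : Matrix (Fin m) (Fin k) ℝ) (N : Matrix (Fin k) (Fin l) ℝ) :
    specNorm (M * N) ≤ specNorm M * specNorm N :=
  Matrix.l2_opNorm_mul M N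

theorem specNorm_transpose {m k : ℕ} (M : Matrix (Fin m) (Fin k) ℝ) :
    specNorm Mᵀ = specNorm M := by
  have h := Matrix.l2_opNorm_conjTranspose M
  rwa [Matrix.conjTranspose_eq_transpose_of_trivial] at h

theorem norm_mulVec_le {m k : ℕ} (M : Matrix (Fin m) (Fin k) ℝ) (x : Fin k → ℝ) :
    ‖WithLp.toLp 2 (M *ᵥ x)‖ ≤ specNorm M * ‖WithLp.toLp 2 x‖ :=
  Matrix.l2_opNorm_mulVec M (WithLp.toLp 2 x)

theorem specNorm_le_of_mulVec {m k : ℕ} (M : Matrix (Fin m) (Fin k) ℝ) {c : ℝ} (hc : 0 ≤ c)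
    (h : ∀ x, ‖WithLp.toLp 2 (M *ᵥ x)‖ ≤ c * ‖WithLp.toLp 2 x‖) : specNorm M ≤ c := by
  rw [specNorm, Matrix.l2_opNorm_def]
  exact ContinuousLinearMap.opNorm_le_bound _ hc fun x => h x.ofLp

theorem specNorm_le_of_sq {m k : ℕ} (M : Matrix (Fin m) (Fin k) ℝ) {c : ℝ} (hc : 0 ≤ c)
    (h : ∀ x, (M *ᵥ x) ⬝ᵥ (M *ᵥ x) ≤ c ^ 2 * (x ⬝ᵥ x)) : specNorm M ≤ c := by
  refine specNorm_le_of_mulVec M hc fun x => ?_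
  have := h x
  rw [← norm_toLp_sq, ← norm_toLp_sq, ← mul_pow] at this
  exact le_of_sq_le_sq this (by positivity)

end SpecNorm

theorem mulVec_dotProduct_mulVec {m k : Type*} [Fintype m] [Fintype k]
    (M : Matrix m k ℝ) (x y : k → ℝ) : (M *ᵥ x) ⬝ᵥ (M *ᵥ y) = x ⬝ᵥ ((Mᵀ * M) *ᵥ y) := by
  rw [← Matrix.mulVec_mulVec, Matrix.dotProduct_mulVec x, Matrix.vecMul_transpose]

theorem specNorm_le_one_of_transpose_mul_self {m k : ℕ} {M : Matrix (Fin m) (Fin k) ℝ}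
    (h : Mᵀ * M = 1) : specNorm M ≤ 1 :=
  specNorm_le_of_sq M zero_le_one fun x => by
    rw [mulVec_dotProduct_mulVec, h, Matrix.one_mulVec]; simp

theorem norm_row_le_twoInftyNorm {m k : ℕ} (M : Matrix (Fin m) (Fin k) ℝ) (i : Fin m) :
    ‖WithLp.toLp 2 (M i)‖ ≤ twoInftyNorm M :=
  le_ciSup (f := fun i => ‖WithLp.toLp 2 (M i)‖) (Set.finite_range _).bddAbove i

theorem twoInftyNorm_le {m k : ℕ} {M : Matrix (Fin m) (Fin k) ℝ} {c : ℝ} (hc : 0 ≤ c)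
    (h : ∀ i, ‖WithLp.toLp 2 (M i)‖ ≤ c) : twoInftyNorm M ≤ c :=
  Real.iSup_le h hc

theorem twoInftyNorm_nonneg {m k : ℕ} (M : Matrix (Fin m) (Fin k) ℝ) : 0 ≤ twoInftyNorm M :=
  Real.iSup_nonneg fun _ => norm_nonneg _

theorem twoInftyNorm_sub_le {m k : ℕ} (M N : Matrix (Fin m) (Fin k) ℝ) :
    twoInftyNorm (M - N) ≤ twoInftyNorm M + twoInftyNorm N :=
  twoInftyNorm_le (add_nonneg (twoInftyNorm_nonneg _) (twoInftyNorm_nonneg _)) fun i =>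
    (norm_sub_le (WithLp.toLp 2 (M i)) (WithLp.toLp 2 (N i))).trans
      (add_le_add (norm_row_le_twoInftyNorm M i) (norm_row_le_twoInftyNorm N i))

theorem twoInftyNorm_smul {m k : ℕ} (c : ℝ) (M : Matrix (Fin m) (Fin k) ℝ) :
    twoInftyNorm (c • M) = |c| * twoInftyNorm M := by
  rw [twoInftyNorm, twoInftyNorm, Real.mul_iSup_of_nonneg (abs_nonneg c)]
  congr 1
  ext i
  exact norm_smul c (WithLp.toLp 2 (M i))

theorem twoInftyNorm_mul_le {m k l : ℕ} (M : Matrix (Fin m) (Fin k) ℝ)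
    (N : Matrix (Fin k) (Fin l) ℝ) :
    twoInftyNorm (M * N) ≤ twoInftyNorm M * specNorm N := by
  refine twoInftyNorm_le (mul_nonneg (twoInftyNorm_nonneg _) (specNorm_nonneg _)) fun i => ?_
  have h := norm_mulVec_le Nᵀ (M i)
  rw [Matrix.mulVec_transpose, specNorm_transpose, mul_comm] at h
  exact (le_of_eq rfl).trans (h.trans
    (mul_le_mul_of_nonneg_right (norm_row_le_twoInftyNorm M i) (specNorm_nonneg _)))

/-- Cauchy–Schwarz in each row, summed over the `m` rows. -/
theorem specNorm_le_sqrt_mul_twoInftyNorm {m k : ℕ} (M : Matrix (Fin m) (Fin k) ℝ) :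
    specNorm M ≤ √(m : ℝ) * twoInftyNorm M := by
  refine specNorm_le_of_sq M (mul_nonneg (Real.sqrt_nonneg _) (twoInftyNorm_nonneg _)) fun x => ?_
  rw [mul_pow, Real.sq_sqrt (Nat.cast_nonneg m)]
  have h : ∀ i ∈ Finset.univ, (M *ᵥ x) i * (M *ᵥ x) i ≤ twoInftyNorm M ^ 2 * (x ⬝ᵥ x) := by
    intro i _
    rw [← norm_toLp_sq, ← mul_pow, ← sq]
    refine sq_le_sq' ?_ ?_
    all_goals
      have h1 := (abs_dotProduct_le_norm (M i) x).trans
        (mul_le_mul_of_nonneg_right (norm_row_le_twoInftyNorm M i) (norm_nonneg _))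
      have h2 := abs_le.1 h1
    · exact h2.1
    · exact h2.2
  have h3 := Finset.sum_le_sum h
  simp only [Finset.sum_const, Finset.card_univ, Fintype.card_fin, nsmul_eq_mul] at h3
  rw [mul_assoc]
  exact h3

/-! ### Extremal eigenvectors of symmetric matrices. -/

/-- The variational characterization of the least eigenvalue of a symmetric matrix. -/
theorem exists_min_eigenvector {k : ℕ} (hk : 0 < k) {T : Matrix (Fin k) (Fin k) ℝ}
    (hT : T.IsHermitian) :
    ∃ (s : ℝ) (w : Fin k → ℝ), w ⬝ᵥ w = 1 ∧ T *ᵥ w = s • w ∧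
      ∀ x, s * (x ⬝ᵥ x) ≤ x ⬝ᵥ (T *ᵥ x) := by
  have : Nonempty (Fin k) := ⟨⟨0, hk⟩⟩
  obtain ⟨i, hi⟩ := Finite.exists_min hT.eigenvalues
  refine ⟨hT.eigenvalues i, (hT.eigenvectorBasis i).ofLp, ?_, hT.mulVec_eigenvectorBasis i, ?_⟩
  · rw [← norm_toLp_sq]
    change ‖hT.eigenvectorBasis i‖ ^ 2 = 1
    rw [hT.eigenvectorBasis.norm_eq_one, one_pow]
  · intro x
    have hpsd : (T - hT.eigenvalues i • (1 : Matrix (Fin k) (Fin k) ℝ)).PosSemidef := by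
      have h1 : T - hT.eigenvalues i • (1 : Matrix (Fin k) (Fin k) ℝ)
          = (hT.eigenvectorUnitary : Matrix (Fin k) (Fin k) ℝ)
            * Matrix.diagonal (fun j => hT.eigenvalues j - hT.eigenvalues i)
            * (hT.eigenvectorUnitary : Matrix (Fin k) (Fin k) ℝ)ᴴ := by
        have hu : (hT.eigenvectorUnitary : Matrix (Fin k) (Fin k) ℝ)
            * (hT.eigenvectorUnitary : Matrix (Fin k) (Fin k) ℝ)ᴴ = 1 :=
          Matrix.mem_unitaryGroup_iff.1 hT.eigenvectorUnitary.2
        have hd : Matrix.diagonal (fun j => hT.eigenvalues j - hT.eigenvalues i)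
            = Matrix.diagonal hT.eigenvalues
              - hT.eigenvalues i • (1 : Matrix (Fin k) (Fin k) ℝ) := by
          rw [Matrix.smul_one_eq_diagonal, Matrix.diagonal_sub]
        rw [hd, mul_sub, sub_mul, mul_smul_comm, smul_mul_assoc, mul_one, hu]
        congr 1
        exact hT.spectral_theorem
      rw [h1]
      exact (Matrix.PosSemidef.diagonal fun j => sub_nonneg.2 (hi j)).mul_mul_conjTranspose_same _
    have := hpsd.dotProduct_mulVec_nonneg x
    rw [star_trivial, Matrix.sub_mulVec, Matrix.smul_mulVec, Matrix.one_mulVec, dotProduct_sub,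
      dotProduct_smul, smul_eq_mul] at this
    linarith

/-- The variational characterization of the greatest eigenvalue of a symmetric matrix. -/
theorem exists_max_eigenvector {k : ℕ} (hk : 0 < k) {T : Matrix (Fin k) (Fin k) ℝ}
    (hT : T.IsHermitian) :
    ∃ (s : ℝ) (w : Fin k → ℝ), w ⬝ᵥ w = 1 ∧ T *ᵥ w = s • w ∧
      ∀ x, x ⬝ᵥ (T *ᵥ x) ≤ s * (x ⬝ᵥ x) := by
  obtain ⟨s, w, h1, h2, h3⟩ := exists_min_eigenvector hk hT.neg
  refine ⟨-s, w, h1, ?_, fun x => ?_⟩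
  · rw [Matrix.neg_mulVec] at h2
    rw [neg_smul, ← h2, neg_neg]
  · have := h3 x
    rw [Matrix.neg_mulVec, dotProduct_neg] at this
    linarith

/-! ### Orthogonal complements and the spectrum off a leading invariant subspace. -/

theorem exists_orthonormal_complement {n r : ℕ} (hr : r < n) {Q : Matrix (Fin n) (Fin r) ℝ}
    (hQ : Qᵀ * Q = 1) :
    ∃ W : Matrix (Fin n) (Fin (n - r)) ℝ, Wᵀ * W = 1 ∧ Qᵀ * W = 0 := by
  let v : Fin r ⊕ Fin (n - r) → EuclideanSpace ℝ (Fin n) :=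
    Sum.elim (fun i => WithLp.toLp 2 (Qᵀ i)) (fun _ => 0)
  have hv : Orthonormal ℝ ((Set.range Sum.inl : Set (Fin r ⊕ Fin (n - r))).domRestrict v) := by
    rw [orthonormal_iff_ite]
    rintro ⟨_, i, rfl⟩ ⟨_, j, rfl⟩
    have h := congrFun (congrFun hQ j) i
    rw [Matrix.one_apply] at h
    refine Eq.trans h (if_congr ⟨?_, fun h' => (Sum.inl.inj (Subtype.ext_iff.1 h')).symm⟩ rfl rfl)
    rintro rfl
    rfl
  obtain ⟨b, hb⟩ := hv.exists_orthonormalBasis_extension_of_card_eq (by simp; omega)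
  refine ⟨Matrix.of fun i j => b (Sum.inr j) i, ?_, ?_⟩
  · ext i j
    have h := orthonormal_iff_ite.1 b.orthonormal (Sum.inr j) (Sum.inr i)
    rw [Matrix.one_apply]
    simp only [Sum.inr.injEq, eq_comm (a := j)] at h
    exact h
  · ext i j
    have h := orthonormal_iff_ite.1 b.orthonormal (Sum.inr j) (Sum.inl i)
    rw [hb _ ⟨i, rfl⟩, if_neg Sum.inr_ne_inl, real_inner_comm] at h
    rw [Matrix.mul_apply, Matrix.zero_apply, ← h]
    exact Finset.sum_congr rfl fun _ _ => mul_comm _ _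

theorem mul_transpose_add_mul_transpose {n r : ℕ} (hr : r < n) {V : Matrix (Fin n) (Fin r) ℝ}
    {W : Matrix (Fin n) (Fin (n - r)) ℝ} (hV : Vᵀ * V = 1) (hW : Wᵀ * W = 1) (hVW : Vᵀ * W = 0) :
    V * Vᵀ + W * Wᵀ = 1 := by
  have hWV : Wᵀ * V = 0 := by
    have := congrArg Matrix.transpose hVW
    simpa using this
  rw [← Matrix.fromCols_mul_fromRows]
  refine (Matrix.mul_eq_one_comm_of_card_eq _ _ _ (by simp; omega)).1 ?_
  rw [Matrix.fromRows_mul_fromCols, hV, hW, hVW, hWV, Matrix.fromBlocks_one]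

/-- In the orthonormal basis `[Q W]` the matrix `M` is block upper triangular. This identifies the
eigenvalues left over after removing those of `S`, multiplicities included. -/
theorem charpoly_eq_mul_of_invariant {R : Type*} [CommRing R] [Nontrivial R] {n r : ℕ} (hr : r < n)
    {M : Matrix (Fin n) (Fin n) R} {Q : Matrix (Fin n) (Fin r) R}
    {W : Matrix (Fin n) (Fin (n - r)) R} {S : Matrix (Fin r) (Fin r) R}
    (hQ : Qᵀ * Q = 1) (hW : Wᵀ * W = 1) (hQW : Qᵀ * W = 0) (hinv : M * Q = Q * S) :
    M.charpoly = S.charpoly * (Wᵀ * M * W).charpoly := by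
  have hWQ : Wᵀ * Q = 0 := by
    have := congrArg Matrix.transpose hQW
    simpa using this
  have h1 : Matrix.fromRows Qᵀ Wᵀ * Matrix.fromCols Q W = 1 := by
    rw [Matrix.fromRows_mul_fromCols, hQ, hW, hQW, hWQ, Matrix.fromBlocks_one]
  have h2 : Matrix.fromCols Q W * Matrix.fromRows Qᵀ Wᵀ = 1 := by
    exact (Matrix.mul_eq_one_comm_of_card_eq _ _ _ (by simp; omega)).1 h1
  have h3 : Matrix.fromRows Qᵀ Wᵀ * (M * Matrix.fromCols Q W)
      = Matrix.fromBlocks S (Qᵀ * M * W) 0 (Wᵀ * M * W) := by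
    rw [Matrix.mul_fromCols, Matrix.fromRows_mul_fromCols, hinv, ← Matrix.mul_assoc,
      ← Matrix.mul_assoc, ← Matrix.mul_assoc, ← Matrix.mul_assoc, hQ, hWQ, Matrix.one_mul,
      Matrix.zero_mul]
  rw [← Matrix.charpoly_fromBlocks_zero₂₁, ← h3,
    Matrix.charpoly_mul_comm_of_le _ _ (by simp; omega)]
  rw [Matrix.mul_assoc, h2, Matrix.mul_one]
  simp [Nat.add_sub_cancel' hr.le]

theorem mem_cEigenvalues_of_mulVec_eq {k : ℕ} {T : Matrix (Fin k) (Fin k) ℝ} {s : ℝ}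
    {w : Fin k → ℝ} (hw : w ⬝ᵥ w = 1) (h : T *ᵥ w = s • w) : (s : ℂ) ∈ cEigenvalues T := by
  have hroot : T.charpoly.IsRoot s := by
    rw [← Matrix.mem_spectrum_iff_isRoot_charpoly, ← Matrix.spectrum_toLin',
      ← Module.End.hasEigenvalue_iff_mem_spectrum]
    refine Module.End.hasEigenvalue_of_hasEigenvector (x := w)
      ⟨Module.End.mem_eigenspace_iff.2 (by simpa using h), ?_⟩
    rintro rfl
    simp at hw
  rw [cEigenvalues, Polynomial.mem_roots (Matrix.charpoly_monic _).ne_zero, Matrix.charpoly_map]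
  exact hroot.map (f := algebraMap ℝ ℂ)

/-- If the columns of `Q` span a leading invariant subspace of `A - E Qᵀ`, then the Rayleigh
quotients of `A` on the orthogonal complement of this subspace are at most the eigenvalues
of the restriction `S`. -/
theorem dotProduct_mulVec_le_of_isLeadingInvariant {n r : ℕ} (hr : r < n)
    {A : Matrix (Fin n) (Fin n) ℝ} (hA : A.IsHermitian)
    {Q : Matrix (Fin n) (Fin r) ℝ} (hQ : Qᵀ * Q = 1)
    {S : Matrix (Fin r) (Fin r) ℝ} {E : Matrix (Fin n) (Fin r) ℝ} (hE : A * Q - Q * S = E)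
    (hlead : IsLeadingInvariant (A - E * Qᵀ) Q)
    {s : ℝ} {w : Fin r → ℝ} (hw : w ⬝ᵥ w = 1) (hSw : S *ᵥ w = s • w)
    {b : Fin n → ℝ} (hb : Qᵀ *ᵥ b = 0) :
    b ⬝ᵥ (A *ᵥ b) ≤ s * (b ⬝ᵥ b) := by
  obtain ⟨W, hW, hQW⟩ := exists_orthonormal_complement hr hQ
  have hinv : (A - E * Qᵀ) * Q = Q * S := by
    rw [Matrix.sub_mul, Matrix.mul_assoc, hQ, Matrix.mul_one, ← hE, sub_sub_cancel]
  have hS : Qᵀ * (A - E * Qᵀ) * Q = S := by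
    rw [Matrix.mul_assoc, hinv, ← Matrix.mul_assoc, hQ, Matrix.one_mul]
  -- The perturbation `E Qᵀ` vanishes on the range of `W`, so the remaining diagonal block is
  -- symmetric although `A - E Qᵀ` need not be. Its eigenvalues are real and bound its Rayleigh
  -- quotients.
  have hWM : Wᵀ * (A - E * Qᵀ) * W = Wᵀ * A * W := by
    rw [Matrix.mul_sub, Matrix.sub_mul, Matrix.mul_assoc Wᵀ (E * Qᵀ), Matrix.mul_assoc E, hQW,
      Matrix.mul_zero, Matrix.mul_zero, sub_zero]
  have hsub : cEigenvalues (A - E * Qᵀ) - cEigenvalues S = cEigenvalues (Wᵀ * A * W) := by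
    have h := charpoly_eq_mul_of_invariant hr hQ hW hQW hinv
    rw [hWM] at h
    simp only [cEigenvalues, Matrix.charpoly_map, h, Polynomial.map_mul]
    rw [Polynomial.roots_mul, add_tsub_cancel_left]
    rw [← Matrix.charpoly_map, ← Matrix.charpoly_map]
    exact mul_ne_zero (Matrix.charpoly_monic _).ne_zero (Matrix.charpoly_monic _).ne_zero
  have hWAW : (Wᵀ * A * W).IsHermitian := by
    have := Matrix.isHermitian_conjTranspose_mul_mul W hA
    rwa [Matrix.conjTranspose_eq_transpose_of_trivial] at this
  obtain ⟨t, z, hz, hTz, hmax⟩ := exists_max_eigenvector (Nat.sub_pos_of_lt hr) hWAW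
  have hts : t ≤ s := by
    have h := hlead.2
    rw [hS, hsub] at h
    simpa using h _ (mem_cEigenvalues_of_mulVec_eq hw hSw) _ (mem_cEigenvalues_of_mulVec_eq hz hTz)
  have hbW : b = W *ᵥ (Wᵀ *ᵥ b) := by
    have h := congrArg (· *ᵥ b) (mul_transpose_add_mul_transpose hr hQ hW hQW)
    simp only [Matrix.add_mulVec, ← Matrix.mulVec_mulVec, hb, Matrix.mulVec_zero, zero_add,
      Matrix.one_mulVec] at h
    exact h.symm
  have h1 : b ⬝ᵥ b = (Wᵀ *ᵥ b) ⬝ᵥ (Wᵀ *ᵥ b) := by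
    conv_lhs => rw [hbW]
    rw [mulVec_dotProduct_mulVec, hW, Matrix.one_mulVec]
  have h2 : b ⬝ᵥ (A *ᵥ b) = (Wᵀ *ᵥ b) ⬝ᵥ ((Wᵀ * A * W) *ᵥ (Wᵀ *ᵥ b)) := by
    rw [← Matrix.mulVec_mulVec, ← Matrix.mulVec_mulVec, ← hbW, Matrix.dotProduct_mulVec _ Wᵀ,
      Matrix.vecMul_transpose, ← hbW]
  rw [h2, h1]
  refine (hmax _).trans (mul_le_mul_of_nonneg_right hts ?_)
  rw [← norm_toLp_sq]
  positivity

open scoped MatrixOrder in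
/-- The positive semidefinite square root of `C Cᵀ`. -/
theorem exists_sqrt_mul_transpose {k : ℕ} (C : Matrix (Fin k) (Fin k) ℝ) :
    ∃ P : Matrix (Fin k) (Fin k) ℝ, P.PosSemidef ∧ P * P = C * Cᵀ := by
  have h : (C * Cᵀ).PosSemidef := by
    have := Matrix.posSemidef_self_mul_conjTranspose C
    rwa [Matrix.conjTranspose_eq_transpose_of_trivial] at this
  exact ⟨CFC.sqrt (C * Cᵀ), Matrix.nonneg_iff_posSemidef.1 (CFC.sqrt_nonneg _),
    CFC.sqrt_mul_sqrt_self _ h.nonneg⟩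

/-! ### Spectral position of `S`, the Sylvester operator and the separation. -/

/-- A lower bound for the least eigenvalue `s` of the Rayleigh-type block `S` in terms of a lower
bound for `A` on an `r`-dimensional subspace and of the residual `E = A Q - Q S`. -/
theorem le_add_two_mul_specNorm {n r : ℕ} {A : Matrix (Fin n) (Fin n) ℝ} (hA : Aᵀ = A)
    {V Q : Matrix (Fin n) (Fin r) ℝ} (hV : Vᵀ * V = 1) (hQ : Qᵀ * Q = 1)
    {S : Matrix (Fin r) (Fin r) ℝ} {E : Matrix (Fin n) (Fin r) ℝ} (hE : A * Q - Q * S = E)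
    {s : ℝ} {w : Fin r → ℝ} (hw : w ⬝ᵥ w = 1) (hSw : S *ᵥ w = s • w)
    (hb : ∀ b, Qᵀ *ᵥ b = 0 → b ⬝ᵥ (A *ᵥ b) ≤ s * (b ⬝ᵥ b))
    {l : ℝ} (hl : ∀ u, l * (u ⬝ᵥ u) ≤ (V *ᵥ u) ⬝ᵥ (A *ᵥ (V *ᵥ u))) :
    l ≤ s + 2 * specNorm E := by
  -- A map from dimension `r + 1` to dimension `r` has a nonzero kernel. This yields a nonzero
  -- vector `V u = a q + b` with `q = Q w` and `b` orthogonal to the range of `Q`, on which both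
  -- Rayleigh bounds can be compared.
  let f : ((Fin r → ℝ) × ℝ) →ₗ[ℝ] (Fin r → ℝ) :=
    (Matrix.mulVecLin (Qᵀ * V)).comp (LinearMap.fst ℝ _ _)
      - (LinearMap.toSpanSingleton ℝ _ w).comp (LinearMap.snd ℝ _ _)
  obtain ⟨⟨u, a⟩, hker, hne⟩ := Submodule.exists_mem_ne_zero_of_ne_bot
    (LinearMap.ker_ne_bot_of_finrank_lt (f := f) (by simp))
  have hua : Qᵀ *ᵥ (V *ᵥ u) = a • w := by
    have h : f (u, a) = 0 := hker
    simp only [f, LinearMap.sub_apply, LinearMap.comp_apply, LinearMap.fst_apply,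
      LinearMap.snd_apply, Matrix.mulVecLin_apply, LinearMap.toSpanSingleton_apply] at h
    rw [Matrix.mulVec_mulVec]
    exact sub_eq_zero.1 h
  have hu : u ≠ 0 := by
    rintro rfl
    rw [Matrix.mulVec_zero, Matrix.mulVec_zero] at hua
    have ha : a = 0 := by
      have h := congrArg (· ⬝ᵥ w) hua
      simpa [smul_dotProduct, hw] using h.symm
    exact hne (by simp [ha])
  obtain ⟨q, hq⟩ : ∃ q, q = Q *ᵥ w := ⟨_, rfl⟩
  obtain ⟨b, hbdef⟩ : ∃ b, b = V *ᵥ u - a • q := ⟨_, rfl⟩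
  have hv : V *ᵥ u = a • q + b := by rw [hbdef]; abel
  have hQb : Qᵀ *ᵥ b = 0 := by
    rw [hbdef, Matrix.mulVec_sub, hua, Matrix.mulVec_smul, hq, Matrix.mulVec_mulVec, hQ,
      Matrix.one_mulVec, sub_self]
  have hqq : q ⬝ᵥ q = 1 := by
    rw [hq, mulVec_dotProduct_mulVec, hQ, Matrix.one_mulVec, hw]
  have hbq : b ⬝ᵥ q = 0 := by
    rw [hq, Matrix.dotProduct_mulVec, ← Matrix.mulVec_transpose, hQb, zero_dotProduct]
  have hqb : q ⬝ᵥ b = 0 := by rw [dotProduct_comm, hbq]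
  have hAq : A *ᵥ q = s • q + E *ᵥ w := by
    rw [← hE, Matrix.sub_mulVec, ← Matrix.mulVec_mulVec, ← Matrix.mulVec_mulVec, hSw,
      Matrix.mulVec_smul, ← hq]
    abel
  -- By symmetry of `A`, the cross term sees only the residual, because `A q = s q + E w` and `b ⟂
  -- q`.
  have hqAb : q ⬝ᵥ (A *ᵥ b) = b ⬝ᵥ (E *ᵥ w) := by
    rw [Matrix.dotProduct_mulVec, ← Matrix.mulVec_transpose, hA, hAq, dotProduct_comm,
      dotProduct_add, dotProduct_smul, hbq, smul_zero, zero_add]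
  have hvv : u ⬝ᵥ u = a ^ 2 + b ⬝ᵥ b := by
    have h : (V *ᵥ u) ⬝ᵥ (V *ᵥ u) = u ⬝ᵥ u := by
      rw [mulVec_dotProduct_mulVec, hV, Matrix.one_mulVec]
    rw [← h, hv]
    simp only [dotProduct_add, add_dotProduct, smul_dotProduct, dotProduct_smul, hqq, hbq, hqb,
      smul_eq_mul]
    ring
  have hvAv : (V *ᵥ u) ⬝ᵥ (A *ᵥ (V *ᵥ u))
      = s * a ^ 2 + a * ((a • q + (2 : ℝ) • b) ⬝ᵥ (E *ᵥ w)) + b ⬝ᵥ (A *ᵥ b) := by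
    rw [hv]
    simp only [Matrix.mulVec_add, Matrix.mulVec_smul, dotProduct_add, add_dotProduct,
      smul_dotProduct, dotProduct_smul, hqAb, hAq, hqq, hbq, smul_eq_mul]
    ring
  have hbb : 0 ≤ b ⬝ᵥ b := by rw [← norm_toLp_sq]; positivity
  have hpos : 0 < u ⬝ᵥ u := by
    rw [← norm_toLp_sq]
    have : WithLp.toLp 2 u ≠ 0 := fun h => hu (by simpa using h)
    positivity
  have hnw : ‖WithLp.toLp 2 w‖ = 1 := norm_toLp_eq_one hw
  have ha : |a| ≤ √(u ⬝ᵥ u) := Real.abs_le_sqrt (by linarith)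
  -- The squared norm is `a² + 4‖b‖² ≤ 4‖u‖²`; this is the source of the constant 2 in the
  -- conclusion.
  have hc : ‖WithLp.toLp 2 (a • q + (2 : ℝ) • b)‖ ≤ 2 * √(u ⬝ᵥ u) := by
    refine le_of_sq_le_sq ?_ (by positivity)
    rw [mul_pow, Real.sq_sqrt hpos.le, norm_toLp_sq]
    simp only [dotProduct_add, add_dotProduct, smul_dotProduct, dotProduct_smul, hqq, hbq, hqb,
      smul_eq_mul]
    nlinarith [sq_nonneg a]
  have hEw : ‖WithLp.toLp 2 (E *ᵥ w)‖ ≤ specNorm E := by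
    have := norm_mulVec_le E w
    rwa [hnw, mul_one] at this
  have hcross : a * ((a • q + (2 : ℝ) • b) ⬝ᵥ (E *ᵥ w)) ≤ 2 * specNorm E * (u ⬝ᵥ u) := by
    calc a * ((a • q + (2 : ℝ) • b) ⬝ᵥ (E *ᵥ w))
        ≤ |a| * |(a • q + (2 : ℝ) • b) ⬝ᵥ (E *ᵥ w)| := by
          rw [← abs_mul]; exact le_abs_self _
      _ ≤ √(u ⬝ᵥ u) * (2 * √(u ⬝ᵥ u) * specNorm E) := by
          refine mul_le_mul ha ?_ (abs_nonneg _) (Real.sqrt_nonneg _)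
          exact (abs_dotProduct_le_norm _ _).trans
            (mul_le_mul hc hEw (norm_nonneg _) (by positivity))
      _ = 2 * specNorm E * (√(u ⬝ᵥ u) * √(u ⬝ᵥ u)) := by ring
      _ = 2 * specNorm E * (u ⬝ᵥ u) := by rw [Real.mul_self_sqrt hpos.le]
  have hfin : l * (u ⬝ᵥ u) ≤ (s + 2 * specNorm E) * (u ⬝ᵥ u) := by
    have h1 := hl u
    have h2 := hb b hQb
    rw [hvAv] at h1
    rw [hvv] at h1 hcross ⊢
    linarith
  exact le_of_mul_le_mul_right hfin hpos

/-- The Sylvester operator `D ↦ B D - D S` is bounded below by the separation of `S` and `B`. -/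
theorem sub_mul_specNorm_le {r m : ℕ} (hr : 0 < r) {S : Matrix (Fin r) (Fin r) ℝ}
    {B : Matrix (Fin m) (Fin m) ℝ} {s c : ℝ} (hsc : c ≤ s)
    (hS : ∀ x, s * (x ⬝ᵥ x) ≤ x ⬝ᵥ (S *ᵥ x)) (hB : ∀ y, y ⬝ᵥ (B *ᵥ y) ≤ c * (y ⬝ᵥ y))
    (D : Matrix (Fin m) (Fin r) ℝ) :
    (s - c) * specNorm D ≤ specNorm (B * D - D * S) := by
  have hDD : (Dᵀ * D).IsHermitian := by
    have := Matrix.isHermitian_conjTranspose_mul_self D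
    rwa [Matrix.conjTranspose_eq_transpose_of_trivial] at this
  -- Here `x` is a top right singular vector of `D`. Pairing `(B D - D S) x` with `D x` turns the
  -- `S` term into `σ² ⟨x, S x⟩`, since `Dᵀ D x = σ² x`.
  obtain ⟨t, x, hx, htx, hmax⟩ := exists_max_eigenvector hr hDD
  have hnx : ‖WithLp.toLp 2 x‖ = 1 := norm_toLp_eq_one hx
  have ht : ‖WithLp.toLp 2 (D *ᵥ x)‖ ^ 2 = t := by
    rw [norm_toLp_sq, mulVec_dotProduct_mulVec, htx, dotProduct_smul, hx, smul_eq_mul, mul_one]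
  obtain ⟨σ, hσ⟩ : ∃ σ, σ = ‖WithLp.toLp 2 (D *ᵥ x)‖ := ⟨_, rfl⟩
  rw [← hσ] at ht
  have hσ0 : 0 ≤ σ := hσ ▸ norm_nonneg _
  have hDσ : specNorm D ≤ σ := specNorm_le_of_sq D hσ0 fun y => by
    rw [ht, mulVec_dotProduct_mulVec]; exact hmax y
  have hyy : (D *ᵥ x) ⬝ᵥ (D *ᵥ x) = σ ^ 2 := by rw [← norm_toLp_sq, ← hσ]
  have hK : (D *ᵥ x) ⬝ᵥ ((B * D - D * S) *ᵥ x)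
      = (D *ᵥ x) ⬝ᵥ (B *ᵥ (D *ᵥ x)) - σ ^ 2 * (x ⬝ᵥ (S *ᵥ x)) := by
    rw [Matrix.sub_mulVec, dotProduct_sub, ← Matrix.mulVec_mulVec, ← Matrix.mulVec_mulVec]
    congr 1
    rw [dotProduct_comm, mulVec_dotProduct_mulVec, htx, dotProduct_smul, ht, smul_eq_mul,
      dotProduct_comm]
  have hKle : |(D *ᵥ x) ⬝ᵥ ((B * D - D * S) *ᵥ x)| ≤ σ * specNorm (B * D - D * S) := by
    refine (abs_dotProduct_le_norm _ _).trans ?_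
    rw [← hσ]
    refine mul_le_mul_of_nonneg_left ?_ hσ0
    have := norm_mulVec_le (B * D - D * S) x
    rwa [hnx, mul_one] at this
  have h1 := hB (D *ᵥ x)
  have h2 := mul_le_mul_of_nonneg_left (hS x) (sq_nonneg σ)
  rw [hyy] at h1
  rw [hx] at h2
  have h3 := neg_le_of_abs_le hKle
  rw [hK] at h3
  have h4 : σ * ((s - c) * σ) ≤ σ * specNorm (B * D - D * S) := by nlinarith
  refine (mul_le_mul_of_nonneg_left hDσ (sub_nonneg.2 hsc)).trans ?_
  rcases hσ0.eq_or_lt with h0 | h0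
  · rw [← h0, mul_zero]; exact specNorm_nonneg _
  · exact le_of_mul_le_mul_left h4 h0

/-- Homogeneity: `W X` is rescaled to norm one, unless its norm is zero and the bound is trivial. -/
theorem sep_mul_twoInftyNorm_le {n r m : ℕ} (W : Matrix (Fin n) (Fin m) ℝ)
    (B : Matrix (Fin r) (Fin r) ℝ) (C : Matrix (Fin n) (Fin n) ℝ) (X : Matrix (Fin m) (Fin r) ℝ) :
    sep twoInftyNorm W B C * twoInftyNorm (W * X)
      ≤ twoInftyNorm (W * X * B - C * (W * X)) := by
  rcases (twoInftyNorm_nonneg (W * X)).eq_or_lt with h0 | h0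
  · rw [← h0, mul_zero]; exact twoInftyNorm_nonneg _
  · rw [← le_div_iff₀ h0]
    refine csInf_le ⟨0, ?_⟩
      ⟨(twoInftyNorm (W * X))⁻¹ • (W * X), ?_, ⟨(twoInftyNorm (W * X))⁻¹ • X, ?_⟩, ?_⟩
    · rintro _ ⟨Z, -, -, rfl⟩
      exact twoInftyNorm_nonneg _
    · rw [twoInftyNorm_smul, abs_of_pos (inv_pos.2 h0), inv_mul_cancel₀ h0.ne']
    · rw [Matrix.mul_smul]
    · rw [Matrix.smul_mul, Matrix.mul_smul, ← smul_sub, twoInftyNorm_smul,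
        abs_of_pos (inv_pos.2 h0), div_eq_inv_mul]

/-! ### Polar factors and inverses. -/

/-- The orthogonal polar factor `O` of an invertible matrix makes `C O` positive semidefinite,
and `C O` is at least as close to the identity as `C Cᵀ`. -/
theorem exists_orthogonal_specNorm_one_sub_mul_le {k : ℕ} {C : Matrix (Fin k) (Fin k) ℝ}
    (hC : IsUnit C.det) :
    ∃ O ∈ Matrix.orthogonalGroup (Fin k) ℝ,
      specNorm (1 - C * O) ≤ specNorm (1 - C * Cᵀ) := by
  obtain ⟨P, hP, hPP⟩ := exists_sqrt_mul_transpose C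
  have hPt : Pᵀ = P := by
    have := hP.isHermitian
    rwa [Matrix.IsHermitian, Matrix.conjTranspose_eq_transpose_of_trivial] at this
  refine ⟨C⁻¹ * P, ?_, ?_⟩
  · rw [Matrix.mem_orthogonalGroup_iff, Matrix.transpose_mul, hPt]
    calc C⁻¹ * P * (P * C⁻¹ᵀ) = C⁻¹ * (P * P) * C⁻¹ᵀ := by simp only [Matrix.mul_assoc]
      _ = (C⁻¹ * C) * (C⁻¹ * C)ᵀ := by
        rw [hPP, Matrix.transpose_mul]; simp only [Matrix.mul_assoc]
      _ = 1 := by rw [Matrix.nonsing_inv_mul C hC]; simp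
  · rw [← Matrix.mul_assoc, Matrix.mul_nonsing_inv C hC, Matrix.one_mul]
    refine specNorm_le_of_mulVec _ (specNorm_nonneg _) fun x => ?_
    refine le_trans ?_ (norm_mulVec_le _ x)
    -- Since `P` is positive semidefinite, `1 + P` does not shrink any vector, so `‖(1 - P) x‖ ≤ ‖(1
    -- - C Cᵀ) x‖`.
    have hfac : 1 - C * Cᵀ = (1 + P) * (1 - P) := by rw [← hPP]; noncomm_ring
    rw [hfac, ← Matrix.mulVec_mulVec]
    generalize (1 - P) *ᵥ x = z
    refine le_of_sq_le_sq ?_ (norm_nonneg _)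
    rw [norm_toLp_sq, norm_toLp_sq, Matrix.add_mulVec, Matrix.one_mulVec]
    have h1 := hP.dotProduct_mulVec_nonneg z
    rw [star_trivial] at h1
    have h2 : 0 ≤ (P *ᵥ z) ⬝ᵥ (P *ᵥ z) := by rw [← norm_toLp_sq]; positivity
    rw [add_dotProduct, dotProduct_add, dotProduct_add, dotProduct_comm (P *ᵥ z) z]
    linarith

theorem specNorm_inv_le {k : ℕ} {C : Matrix (Fin k) (Fin k) ℝ} {c : ℝ} (hc : 0 < c)
    (h : ∀ x, c ^ 2 * (x ⬝ᵥ x) ≤ (C *ᵥ x) ⬝ᵥ (C *ᵥ x)) :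
    IsUnit C.det ∧ specNorm C⁻¹ ≤ c⁻¹ := by
  have hdet : IsUnit C.det := by
    rw [isUnit_iff_ne_zero]
    intro h0
    obtain ⟨v, hv, hCv⟩ := Matrix.exists_mulVec_eq_zero_iff.2 h0
    have h1 := h v
    rw [hCv, zero_dotProduct, ← norm_toLp_sq] at h1
    have : WithLp.toLp 2 v ≠ 0 := fun h' => hv (by simpa using h')
    have : 0 < c ^ 2 * ‖WithLp.toLp 2 v‖ ^ 2 := by positivity
    linarith
  refine ⟨hdet, specNorm_le_of_sq _ (inv_pos.2 hc).le fun x => ?_⟩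
  have h1 := h (C⁻¹ *ᵥ x)
  rw [Matrix.mulVec_mulVec, Matrix.mul_nonsing_inv C hdet, Matrix.one_mulVec] at h1
  rwa [inv_pow, ← div_eq_inv_mul, le_div_iff₀ (by positivity), mul_comm]

/-! ### The eigendecomposition of `A` and the Davis–Kahan bound. -/

theorem eig_antitone {n : ℕ} {A : Matrix (Fin n) (Fin n) ℝ} (hA : A.IsHermitian) :
    Antitone (eig hA) := fun _ _ h => hA.eigenvalues₀_antitone h

theorem dotProduct_eigTop_mulVec_ge {n r : ℕ} (hr : r < n) {A : Matrix (Fin n) (Fin n) ℝ}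
    (hA : A.IsHermitian) (x : Fin r → ℝ) :
    eig hA ⟨r - 1, lt_of_le_of_lt (Nat.sub_le r 1) hr⟩ * (x ⬝ᵥ x) ≤ x ⬝ᵥ (eigTop hA hr *ᵥ x) := by
  simp only [eigTop, Matrix.mulVec_diagonal, dotProduct, Finset.mul_sum]
  refine Finset.sum_le_sum fun i _ => ?_
  have h : eig hA ⟨r - 1, lt_of_le_of_lt (Nat.sub_le r 1) hr⟩ ≤ eig hA ⟨i, i.isLt.trans hr⟩ :=
    eig_antitone hA (by simp only [Fin.mk_le_mk]; have := i.isLt; omega)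
  nlinarith [mul_le_mul_of_nonneg_right h (mul_self_nonneg (x i))]

theorem dotProduct_eigBot_mulVec_le {n r : ℕ} (hr : r < n) {A : Matrix (Fin n) (Fin n) ℝ}
    (hA : A.IsHermitian) (x : Fin (n - r) → ℝ) :
    x ⬝ᵥ (eigBot hA r *ᵥ x) ≤ eig hA ⟨r, hr⟩ * (x ⬝ᵥ x) := by
  simp only [eigBot, Matrix.mulVec_diagonal, dotProduct, Finset.mul_sum]
  refine Finset.sum_le_sum fun i _ => ?_
  have h : eig hA ⟨r + i, by have := i.isLt; omega⟩ ≤ eig hA ⟨r, hr⟩ :=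
    eig_antitone hA (by simp)
  nlinarith [mul_le_mul_of_nonneg_right h (mul_self_nonneg (x i))]

theorem transpose_mul_eq_of_decomposition {R : Type*} [CommRing R] {n r m k : ℕ}
    {A : Matrix (Fin n) (Fin n) R}
    {V : Matrix (Fin n) (Fin r) R} {W : Matrix (Fin n) (Fin m) R}
    {L : Matrix (Fin r) (Fin r) R} {B : Matrix (Fin m) (Fin m) R}
    (hV : Vᵀ * V = 1) (hVW : Vᵀ * W = 0) (hdec : A = V * L * Vᵀ + W * B * Wᵀ)
    (Q : Matrix (Fin n) (Fin k) R) : Vᵀ * (A * Q) = L * (Vᵀ * Q) := by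
  rw [hdec, Matrix.add_mul, Matrix.mul_add, Matrix.mul_assoc (W * B), Matrix.mul_assoc W,
    ← Matrix.mul_assoc Vᵀ W, hVW, Matrix.zero_mul, add_zero, Matrix.mul_assoc (V * L),
    Matrix.mul_assoc V, ← Matrix.mul_assoc Vᵀ V, hV, Matrix.one_mul]

/-- A Davis–Kahan bound for the component `V_⊥ᵀ Q` of the approximate eigenvectors. -/
theorem eigengap_sub_mul_specNorm_le {n r : ℕ} (hr0 : 1 ≤ r) (hr : r < n)
    {A : Matrix (Fin n) (Fin n) ℝ} (hA : A.IsHermitian)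
    {V : Matrix (Fin n) (Fin r) ℝ} {Vp : Matrix (Fin n) (Fin (n - r)) ℝ}
    (hV : Vᵀ * V = 1) (hVp : Vpᵀ * Vp = 1) (hVVp : Vᵀ * Vp = 0)
    (hdec : A = V * eigTop hA hr * Vᵀ + Vp * eigBot hA r * Vpᵀ)
    {Q : Matrix (Fin n) (Fin r) ℝ} (hQ : Qᵀ * Q = 1)
    {S : Matrix (Fin r) (Fin r) ℝ} (hS : S.IsSymm)
    {E : Matrix (Fin n) (Fin r) ℝ} (hE : A * Q - Q * S = E)
    (hlead : IsLeadingInvariant (A - E * Qᵀ) Q)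
    (hsmall : 2 * specNorm E ≤ eigengap hA hr) :
    (eigengap hA hr - 2 * specNorm E) * specNorm (Vpᵀ * Q) ≤ specNorm E := by
  have hVpV : Vpᵀ * V = 0 := by simpa using congrArg Matrix.transpose hVVp
  have hAt : Aᵀ = A := by
    rwa [Matrix.IsHermitian, Matrix.conjTranspose_eq_transpose_of_trivial] at hA
  have hSh : S.IsHermitian := by
    rwa [Matrix.IsHermitian, Matrix.conjTranspose_eq_transpose_of_trivial]
  obtain ⟨s, w, hw, hSw, hmin⟩ := exists_min_eigenvector hr0 hSh
  have hl := le_add_two_mul_specNorm hAt hV hQ hE hw hSw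
    (fun b hb => dotProduct_mulVec_le_of_isLeadingInvariant hr hA hQ hE hlead hw hSw hb)
    (l := eig hA ⟨r - 1, lt_of_le_of_lt (Nat.sub_le r 1) hr⟩) (fun u => by
      have h : (V *ᵥ u) ⬝ᵥ (A *ᵥ (V *ᵥ u)) = u ⬝ᵥ (eigTop hA hr *ᵥ u) := by
        have h1 := transpose_mul_eq_of_decomposition hV hVVp hdec V
        rw [hV, Matrix.mul_one] at h1
        rw [Matrix.mulVec_mulVec, dotProduct_comm, Matrix.dotProduct_mulVec,
          ← Matrix.mulVec_transpose, Matrix.mulVec_mulVec, h1, dotProduct_comm]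
      rw [h]
      exact dotProduct_eigTop_mulVec_ge hr hA u)
  unfold eigengap at hsmall ⊢
  have hsep := sub_mul_specNorm_le hr0 (c := eig hA ⟨r, hr⟩) (s := s) (by linarith) hmin
    (dotProduct_eigBot_mulVec_le hr hA) (Vpᵀ * Q)
  -- Projecting the residual equation onto the range of `V_⊥` gives a Sylvester equation for `V_⊥ᵀ
  -- Q`.
  have hres : eigBot hA r * (Vpᵀ * Q) - Vpᵀ * Q * S = Vpᵀ * E := by
    rw [← transpose_mul_eq_of_decomposition hVp hVpV (hdec.trans (add_comm _ _)) Q,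
      Matrix.mul_assoc, ← Matrix.mul_sub, hE]
  have hVpE : specNorm (Vpᵀ * E) ≤ specNorm E := by
    refine (specNorm_mul_le _ _).trans ?_
    rw [specNorm_transpose]
    exact mul_le_of_le_one_left (specNorm_nonneg _) (specNorm_le_one_of_transpose_mul_self hVp)
  rw [hres] at hsep
  exact (mul_le_mul_of_nonneg_right (by linarith) (specNorm_nonneg _)).trans (hsep.trans hVpE)

/-! ### Row-wise control of `Z` and reduction of the distance to two terms. -/

/-- The equation satisfied by `Z = V_⊥ (V_⊥ᵀ Q) (Vᵀ Q)⁻¹`. -/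
theorem sylvester_mul_inv_eq {R : Type*} [CommRing R] {n r m : ℕ} {A : Matrix (Fin n) (Fin n) R}
    {V : Matrix (Fin n) (Fin r) R} {W : Matrix (Fin n) (Fin m) R}
    {L : Matrix (Fin r) (Fin r) R} {B : Matrix (Fin m) (Fin m) R}
    (hV : Vᵀ * V = 1) (hW : Wᵀ * W = 1) (hVW : Vᵀ * W = 0)
    (hdec : A = V * L * Vᵀ + W * B * Wᵀ)
    {Q : Matrix (Fin n) (Fin r) R} {S : Matrix (Fin r) (Fin r) R} {E : Matrix (Fin n) (Fin r) R}
    (hE : A * Q - Q * S = E) (hC : IsUnit (Vᵀ * Q).det) :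
    W * (Wᵀ * Q * (Vᵀ * Q)⁻¹) * L - W * B * Wᵀ * (W * (Wᵀ * Q * (Vᵀ * Q)⁻¹))
      = (W * (Wᵀ * Q * (Vᵀ * Q)⁻¹) * (Vᵀ * E) - W * Wᵀ * E) * (Vᵀ * Q)⁻¹ := by
  have hWV : Wᵀ * V = 0 := by simpa using congrArg Matrix.transpose hVW
  have hC' := Matrix.mul_nonsing_inv _ hC
  have hC'' := Matrix.nonsing_inv_mul _ hC
  have h1 := transpose_mul_eq_of_decomposition hV hVW hdec Q
  have h2 := transpose_mul_eq_of_decomposition hW hWV (hdec.trans (add_comm _ _)) Q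
  have hVE : Vᵀ * E = L * (Vᵀ * Q) - Vᵀ * Q * S := by
    rw [← hE, Matrix.mul_sub, h1, Matrix.mul_assoc]
  have hWE : Wᵀ * E = B * (Wᵀ * Q) - Wᵀ * Q * S := by
    rw [← hE, Matrix.mul_sub, h2, Matrix.mul_assoc]
  rw [Matrix.mul_assoc W Wᵀ E, hVE, hWE]
  generalize Wᵀ * Q = D at *
  generalize Vᵀ * Q = C at *
  have e1 : W * B * Wᵀ * (W * (D * C⁻¹)) = W * (B * (D * C⁻¹)) := by
    rw [Matrix.mul_assoc (W * B), ← Matrix.mul_assoc Wᵀ W, hW, Matrix.one_mul, Matrix.mul_assoc]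
  have e2 : W * (D * C⁻¹) * (L * C - C * S) = W * (D * C⁻¹ * L * C - D * S) := by
    rw [Matrix.mul_assoc, Matrix.mul_sub, ← Matrix.mul_assoc (D * C⁻¹) C S, Matrix.mul_assoc D C⁻¹ C,
      hC'', Matrix.mul_one, ← Matrix.mul_assoc (D * C⁻¹) L C]
  -- The two `D S` terms cancel, so the equation for `Z` involves `L` in place of `S`, as the
  -- definition of the separation requires.
  have e3 : W * (D * C⁻¹ * L * C - D * S) - W * (B * D - D * S)
      = W * ((D * C⁻¹ * L) * C - B * D) := by
    rw [← Matrix.mul_sub]; congr 1; abel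
  rw [e1, e2, e3, Matrix.mul_assoc W (_ - _), Matrix.sub_mul, Matrix.mul_assoc (D * C⁻¹ * L) C C⁻¹,
    hC', Matrix.mul_one, Matrix.mul_sub, Matrix.mul_assoc B D, Matrix.mul_assoc W]

/-- Writing `W Wᵀ E = E - V Vᵀ E` avoids any row bound on `W`. The loss `√n` in `‖Vᵀ E‖₂ ≤ √n
‖E‖_{2→∞}` is cancelled by the coherence factor `√(r/n)`. -/
theorem twoInftyNorm_complement_mul_le {n r : ℕ} {V : Matrix (Fin n) (Fin r) ℝ}
    {W : Matrix (Fin n) (Fin (n - r)) ℝ} (hn : 0 < n) (hV : Vᵀ * V = 1)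
    (hVW : V * Vᵀ + W * Wᵀ = 1) {μ : ℝ} (hμ : twoInftyNorm V ≤ μ * √((r : ℝ) / n))
    (E : Matrix (Fin n) (Fin r) ℝ) :
    twoInftyNorm (W * Wᵀ * E) ≤ (1 + μ * √(r : ℝ)) * twoInftyNorm E := by
  have h1 : W * Wᵀ * E = E - V * (Vᵀ * E) := by
    rw [eq_sub_of_add_eq' hVW, Matrix.sub_mul, Matrix.one_mul, Matrix.mul_assoc]
  have h2 : specNorm (Vᵀ * E) ≤ √(n : ℝ) * twoInftyNorm E := by
    refine (specNorm_mul_le _ _).trans ?_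
    rw [specNorm_transpose]
    exact (mul_le_of_le_one_left (specNorm_nonneg _)
      (specNorm_le_one_of_transpose_mul_self hV)).trans (specNorm_le_sqrt_mul_twoInftyNorm E)
  have h3 : √((r : ℝ) / n) * √(n : ℝ) = √(r : ℝ) := by
    rw [← Real.sqrt_mul (by positivity), div_mul_cancel₀ _ (by positivity)]
  have h0 := twoInftyNorm_nonneg E
  calc twoInftyNorm (W * Wᵀ * E) ≤ twoInftyNorm E + twoInftyNorm (V * (Vᵀ * E)) := by
        rw [h1]; exact twoInftyNorm_sub_le _ _
    _ ≤ twoInftyNorm E + μ * √((r : ℝ) / n) * (√(n : ℝ) * twoInftyNorm E) := by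
        gcongr
        exact (twoInftyNorm_mul_le _ _).trans
          (mul_le_mul hμ h2 (specNorm_nonneg _) ((twoInftyNorm_nonneg V).trans hμ))
    _ = twoInftyNorm E + μ * (√((r : ℝ) / n) * √(n : ℝ)) * twoInftyNorm E := by ring
    _ = (1 + μ * √(r : ℝ)) * twoInftyNorm E := by rw [h3]; ring

theorem distTwoInfty_le {n r : ℕ} (V U : Matrix (Fin n) (Fin r) ℝ) {O : Matrix (Fin r) (Fin r) ℝ}
    (hO : O ∈ Matrix.orthogonalGroup (Fin r) ℝ) :
    distTwoInfty V U ≤ twoInftyNorm (V - U * O) :=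
  ciInf_le (f := fun O : Matrix.orthogonalGroup (Fin r) ℝ =>
    twoInftyNorm (V - U * (O : Matrix (Fin r) (Fin r) ℝ)))
    ⟨0, by rintro _ ⟨O, rfl⟩; exact twoInftyNorm_nonneg _⟩ ⟨O, hO⟩

theorem transpose_mul_self_add_transpose_mul_self {R : Type*} [CommRing R] {n r m k : ℕ}
    {V : Matrix (Fin n) (Fin r) R} {W : Matrix (Fin n) (Fin m) R} {Q : Matrix (Fin n) (Fin k) R}
    (hQ : Qᵀ * Q = 1) (hVW : V * Vᵀ + W * Wᵀ = 1) :
    (Vᵀ * Q)ᵀ * (Vᵀ * Q) + (Wᵀ * Q)ᵀ * (Wᵀ * Q) = 1 := by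
  calc (Vᵀ * Q)ᵀ * (Vᵀ * Q) + (Wᵀ * Q)ᵀ * (Wᵀ * Q) = Qᵀ * ((V * Vᵀ + W * Wᵀ) * Q) := by
        simp only [Matrix.transpose_mul, Matrix.transpose_transpose, Matrix.mul_add,
          Matrix.add_mul, Matrix.mul_assoc]
    _ = 1 := by rw [hVW, Matrix.one_mul, hQ]

/-- If `Vᵀ Q` is invertible, then `V` is close to `Q` up to its orthogonal polar factor. -/
theorem distTwoInfty_le_add_twoInftyNorm {n r m : ℕ}
    {V Q : Matrix (Fin n) (Fin r) ℝ} {W : Matrix (Fin n) (Fin m) ℝ}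
    (hV : Vᵀ * V = 1) (hQ : Qᵀ * Q = 1)
    (hVW : V * Vᵀ + W * Wᵀ = 1) (hC : IsUnit (Vᵀ * Q).det) :
    distTwoInfty V Q ≤ twoInftyNorm V * (specNorm (Wᵀ * Q) ^ 2 * specNorm (Vᵀ * Q)⁻¹)
      + twoInftyNorm (W * (Wᵀ * Q * (Vᵀ * Q)⁻¹)) := by
  obtain ⟨C, hCdef⟩ : ∃ C, C = Vᵀ * Q := ⟨_, rfl⟩
  obtain ⟨D, hDdef⟩ : ∃ D, D = Wᵀ * Q := ⟨_, rfl⟩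
  have hQCD : Q = V * C + W * D := by
    rw [hCdef, hDdef, ← Matrix.mul_assoc, ← Matrix.mul_assoc, ← Matrix.add_mul, hVW,
      Matrix.one_mul]
  have hCD : Cᵀ * C + Dᵀ * D = 1 := by
    rw [hCdef, hDdef]
    exact transpose_mul_self_add_transpose_mul_self hQ hVW
  rw [← hCdef] at hC ⊢
  rw [← hDdef]
  have hC1 : specNorm C ≤ 1 := by
    rw [hCdef]
    refine (specNorm_mul_le _ _).trans ?_
    rw [specNorm_transpose]
    exact mul_le_one₀ (specNorm_le_one_of_transpose_mul_self hV) (specNorm_nonneg _)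
      (specNorm_le_one_of_transpose_mul_self hQ)
  obtain ⟨O, hO, hCO⟩ := exists_orthogonal_specNorm_one_sub_mul_le hC
  have hO1 : specNorm O ≤ 1 :=
    specNorm_le_one_of_transpose_mul_self ((Matrix.mem_orthogonalGroup_iff' _ _).1 hO)
  have hdiff : V - Q * O = V * (1 - C * O) - W * (D * C⁻¹) * (C * O) := by
    rw [Matrix.mul_assoc W, Matrix.mul_assoc D, ← Matrix.mul_assoc C⁻¹, Matrix.nonsing_inv_mul C hC,
      Matrix.one_mul, Matrix.mul_sub, Matrix.mul_one, hQCD, Matrix.add_mul, Matrix.mul_assoc,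
      Matrix.mul_assoc]
    abel
  -- The relation `Cᵀ C + Dᵀ D = 1` controls `1 - Cᵀ C`; conjugation by `C` carries it to `1 - C
  -- Cᵀ`, at the price of a factor `‖C⁻¹‖`.
  have hCCt : 1 - C * Cᵀ = C * (Dᵀ * D) * C⁻¹ := by
    rw [eq_sub_of_add_eq' hCD, Matrix.mul_sub, Matrix.mul_one, Matrix.sub_mul,
      Matrix.mul_nonsing_inv C hC, Matrix.mul_assoc, Matrix.mul_assoc, Matrix.mul_nonsing_inv C hC,
      Matrix.mul_one]
  have hI : specNorm (1 - C * O) ≤ specNorm D ^ 2 * specNorm C⁻¹ := by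
    refine hCO.trans ?_
    rw [hCCt]
    have h1 : specNorm (Dᵀ * D) ≤ specNorm D ^ 2 := by
      have := specNorm_mul_le Dᵀ D
      rwa [specNorm_transpose, ← sq] at this
    refine (specNorm_mul_le _ _).trans (mul_le_mul_of_nonneg_right ?_ (specNorm_nonneg _))
    exact ((specNorm_mul_le _ _).trans
      (mul_le_of_le_one_left (specNorm_nonneg _) hC1)).trans h1
  refine (distTwoInfty_le V Q hO).trans ?_
  rw [hdiff]
  refine (twoInftyNorm_sub_le _ _).trans (add_le_add ?_ ?_)
  · exact (twoInftyNorm_mul_le _ _).trans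
      (mul_le_mul_of_nonneg_left hI (twoInftyNorm_nonneg _))
  · refine (twoInftyNorm_mul_le _ _).trans
      (mul_le_of_le_one_right (twoInftyNorm_nonneg _) ((specNorm_mul_le _ _).trans ?_))
    exact mul_le_one₀ hC1 (specNorm_nonneg _) hO1

/-- Pythagoras: `‖VᵀQ x‖² + ‖WᵀQ x‖² = ‖x‖²`, so a small sine forces a cosine bounded below. -/
theorem specNorm_transpose_mul_inv_le {n r m : ℕ}
    {V Q : Matrix (Fin n) (Fin r) ℝ} {W : Matrix (Fin n) (Fin m) ℝ} (hQ : Qᵀ * Q = 1)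
    (hVW : V * Vᵀ + W * Wᵀ = 1) {c : ℝ} (hc : 0 < c)
    (hD : specNorm (Wᵀ * Q) ^ 2 + c ^ 2 ≤ 1) :
    IsUnit (Vᵀ * Q).det ∧ specNorm (Vᵀ * Q)⁻¹ ≤ c⁻¹ := by
  refine specNorm_inv_le hc fun x => ?_
  have h1 : ((Vᵀ * Q) *ᵥ x) ⬝ᵥ ((Vᵀ * Q) *ᵥ x) + ((Wᵀ * Q) *ᵥ x) ⬝ᵥ ((Wᵀ * Q) *ᵥ x) = x ⬝ᵥ x := by
    rw [mulVec_dotProduct_mulVec, mulVec_dotProduct_mulVec, ← dotProduct_add, ← Matrix.add_mulVec,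
      transpose_mul_self_add_transpose_mul_self hQ hVW, Matrix.one_mulVec]
  have h2 : ((Wᵀ * Q) *ᵥ x) ⬝ᵥ ((Wᵀ * Q) *ᵥ x) ≤ specNorm (Wᵀ * Q) ^ 2 * (x ⬝ᵥ x) := by
    rw [← norm_toLp_sq, ← norm_toLp_sq, ← mul_pow]
    exact pow_le_pow_left₀ (norm_nonneg _) (norm_mulVec_le _ _) 2
  have h3 : 0 ≤ x ⬝ᵥ x := by rw [← norm_toLp_sq]; positivity
  nlinarith

/-! ### Assembly and constants. -/

theorem corollary1 (n r : ℕ) (hr0 : 1 ≤ r) (hr : r < n)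
    (A : Matrix (Fin n) (Fin n) ℝ) (hA : A.IsHermitian)
    -- eigenvalue decomposition of `A`, with `V` and `Vp` orthonormal and mutually orthogonal
    (V : Matrix (Fin n) (Fin r) ℝ) (Vp : Matrix (Fin n) (Fin (n - r)) ℝ)
    (hV : Vᵀ * V = 1) (hVp : Vpᵀ * Vp = 1) (hVVp : Vᵀ * Vp = 0)
    (hdec : A = V * eigTop hA hr * Vᵀ + Vp * eigBot hA r * Vpᵀ)
    (hgap : 0 < eigengap hA hr)
    (μ : ℝ) (hμ : IsCoherence V μ)
    -- the approximate eigenvectors `Q` and the residual `E`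
    (Q : Matrix (Fin n) (Fin r) ℝ) (hQ : Qᵀ * Q = 1)
    (S : Matrix (Fin r) (Fin r) ℝ) (hS : S.IsSymm)
    (E : Matrix (Fin n) (Fin r) ℝ) (hE : A * Q - Q * S = E)
    (hlead : IsLeadingInvariant (A - E * Qᵀ) Q)
    (hEgap : specNorm E ≤ gap hA hr Vp / 5)
    (ε₁ ε₂ : ℝ) (hε₁ : specNorm E ≤ ε₁) (hε₂ : twoInftyNorm E ≤ ε₂) :
    distTwoInfty V Q ≤
      8 * μ * √((r : ℝ) / n) * (ε₁ / eigengap hA hr) ^ 2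
        + 2 * ((1 + μ * √(r : ℝ)) / gap hA hr Vp)
          * (ε₂ + 2 * (ε₁ * ε₂ / eigengap hA hr)) := by
  have hVW := mul_transpose_add_mul_transpose hr hV hVp hVVp
  have he := specNorm_nonneg E
  have hg5 : gap hA hr Vp ≤ eigengap hA hr := min_le_left _ _
  have hgsep : gap hA hr Vp ≤ sep twoInftyNorm Vp (eigTop hA hr) (Vp * eigBot hA r * Vpᵀ) :=
    min_le_right _ _
  obtain ⟨⟨hμ0, hμV⟩, -⟩ := hμ
  have hDK := eigengap_sub_mul_specNorm_le hr0 hr hA hV hVp hVVp hdec hQ hS hE hlead (by linarith)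
  have hsyl := sylvester_mul_inv_eq hV hVp hVVp hdec hE
  have hsep := sep_mul_twoInftyNorm_le Vp (eigTop hA hr) (Vp * eigBot hA r * Vpᵀ)
    (Vpᵀ * Q * (Vᵀ * Q)⁻¹)
  have hF := twoInftyNorm_complement_mul_le (hr0.trans hr.le) hV hVW hμV E
  have hD0 := specNorm_nonneg (Vpᵀ * Q)
  generalize eigengap hA hr = δ at *
  generalize gap hA hr Vp = g at *
  -- From `‖E‖ ≤ g/5 ≤ δ/5` one gets `δ - 2‖E‖ ≥ 3δ/5`.
  have hD : specNorm (Vpᵀ * Q) ≤ 5 / 3 * (specNorm E / δ) := by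
    rw [mul_div_assoc', le_div_iff₀ hgap]
    nlinarith
  have hD3 : specNorm (Vpᵀ * Q) ≤ 1 / 3 := by
    refine hD.trans ?_
    have : specNorm E / δ ≤ 1 / 5 := by rw [div_le_iff₀ hgap]; linarith
    linarith
  -- The value `9/10` is admissible because `(1/3)² + (9/10)² < 1`.
  obtain ⟨hC, hCinv⟩ := specNorm_transpose_mul_inv_le hQ hVW (c := 9 / 10) (by norm_num)
    (by nlinarith)
  have hdist := distTwoInfty_le_add_twoInftyNorm hV hQ hVW hC
  rw [hsyl hC] at hsep
  have hZ0 := twoInftyNorm_nonneg (Vp * (Vpᵀ * Q * (Vᵀ * Q)⁻¹))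
  have hVE : specNorm (Vᵀ * E) ≤ g / 5 := by
    refine ((specNorm_mul_le _ _).trans ?_).trans hEgap
    rw [specNorm_transpose]
    exact mul_le_of_le_one_left he (specNorm_le_one_of_transpose_mul_self hV)
  have hρ : 0 ≤ 1 + μ * √(r : ℝ) := by positivity
  have hε₁0 := he.trans hε₁
  have hε₂0 := (twoInftyNorm_nonneg E).trans hε₂
  have hg0 : 0 ≤ g := by linarith
  have hZ : twoInftyNorm (Vp * (Vpᵀ * Q * (Vᵀ * Q)⁻¹)) ≤ 2 * ((1 + μ * √(r : ℝ)) / g) * ε₂ := by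
    -- If `g = 0`, division by zero makes the right side `0`; but then `E = 0`, hence `V_⊥ᵀ Q = 0`
    -- and `Z = 0`.
    rcases hg0.eq_or_lt with h0 | h0
    · have hE0 : specNorm E = 0 := by linarith
      have hDz : specNorm (Vpᵀ * Q) = 0 := by
        rw [hE0, zero_div, mul_zero] at hD; linarith
      have hX : twoInftyNorm (Vp * (Vpᵀ * Q * (Vᵀ * Q)⁻¹)) ≤ 0 := by
        refine (twoInftyNorm_mul_le _ _).trans (mul_nonpos_of_nonneg_of_nonpos
          (twoInftyNorm_nonneg _) ((specNorm_mul_le _ _).trans ?_))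
        rw [hDz, zero_mul]
      exact hX.trans (by positivity)
    · have h1 : g * twoInftyNorm (Vp * (Vpᵀ * Q * (Vᵀ * Q)⁻¹))
          ≤ (twoInftyNorm (Vp * (Vpᵀ * Q * (Vᵀ * Q)⁻¹)) * (g / 5)
            + (1 + μ * √(r : ℝ)) * ε₂) * (9 / 10)⁻¹ := by
        refine (mul_le_mul_of_nonneg_right hgsep hZ0).trans (hsep.trans
          ((twoInftyNorm_mul_le _ _).trans ?_))
        refine mul_le_mul ((twoInftyNorm_sub_le _ _).trans (add_le_add ?_ ?_)) hCinv
          (specNorm_nonneg _) (by positivity)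
        · exact (twoInftyNorm_mul_le _ _).trans (mul_le_mul_of_nonneg_left hVE hZ0)
        · exact hF.trans (mul_le_mul_of_nonneg_left hε₂ hρ)
      have h2 : 2 * ((1 + μ * √(r : ℝ)) / g) * ε₂ = 2 * ((1 + μ * √(r : ℝ)) * ε₂) / g := by ring
      rw [h2, le_div_iff₀ h0]
      have h3 : 0 ≤ (1 + μ * √(r : ℝ)) * ε₂ := by positivity
      norm_num at h1
      -- Absorbing `(10/9)(g/5)‖Z‖` on the left leaves `(7/9) g ‖Z‖ ≤ (10/9)(1 + μ√r) ε₂`, and `10/7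
      -- ≤ 2`.
      linarith
  have hV2 : twoInftyNorm V * (specNorm (Vpᵀ * Q) ^ 2 * specNorm (Vᵀ * Q)⁻¹)
      ≤ 8 * μ * √((r : ℝ) / n) * (ε₁ / δ) ^ 2 := by
    have h1 : specNorm (Vpᵀ * Q) ^ 2 ≤ (5 / 3 * (ε₁ / δ)) ^ 2 :=
      pow_le_pow_left₀ hD0 (hD.trans (by gcongr)) 2
    calc _ ≤ μ * √((r : ℝ) / n) * ((5 / 3 * (ε₁ / δ)) ^ 2 * (9 / 10)⁻¹) :=
          mul_le_mul hμV (mul_le_mul h1 hCinv (specNorm_nonneg _) (by positivity))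
            (mul_nonneg (sq_nonneg _) (specNorm_nonneg _)) (by positivity)
      _ = 250 / 81 * (μ * √((r : ℝ) / n) * (ε₁ / δ) ^ 2) := by ring
      _ ≤ 8 * (μ * √((r : ℝ) / n) * (ε₁ / δ) ^ 2) := by gcongr; norm_num
      _ = _ := by ring
  refine hdist.trans (add_le_add hV2 (hZ.trans ?_))
  -- The bound on `Z` needs only `ε₂`; the mixed term `2 ε₁ ε₂ / δ` is nonnegative slack.
  refine mul_le_mul_of_nonneg_left (le_add_of_nonneg_right ?_) (by positivity)
  positivity
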